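/- Let $d\ge 2$, let $|\cdot|$ be Lebesgue measure on $\mathbb{R}^d$, and let $Q(x,r)$ be the open axis-parallel cube with center $x$ and side length $r$. For $\Omega$ of finite positive measure put $d_\Omega(A)=|A\cap\Omega|/|\Omega|$, and let $\bar d(A)=\limsup_{R\to\infty}d_{Q(0,R)}(A)$. A property $P$ is a predicate on the Lebesgue measurable subsets of $\mathbb{R}^d$; all sets $A,B,A_1,A_2$ below are measurable. Put $m(P)=\sup\{\bar d(A): A \text{ has } P\}$, and for $\delta,\epsilon$ with $\delta>0$ put $\mathcal Z_\delta(\epsilon)A=\{x\in\mathbb{R}^d: |Q(x,\delta)\cap A|>\epsilon|Q(x,\delta)|\}$. $P$ is supersaturable if there is a function $I$ from the measurable sets to $[0,\infty]$ such that: (I) $m(P)>0$; (II) if $B\subset A$, then $I(B)\le I(A)$, and $B$ has $P$ whenever $A$ does; (III) if $I(A)>0$, then $A$ does not have $P$; (IV) $P$ and $I$ are translation-invariant; (V) there is a real number $D$ such that, whenever $A_1,A_2$ are at distance at least $D$ from each other, $I(A_1\cup A_2)\ge I(A_1)+I(A_2)$, and $A_1\cup A_2$ has $P$ if and only if both $A_1$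 and $A_2$ have $P$; (VI) there are $\epsilon>0$ and a strictly positive function $f$ on $(0,\infty)$ such that $I(A)\ge f(\delta)$ whenever $\delta>0$ and $\mathcal Z_\delta(1-\epsilon)A$ does not have $P$; (VII) there are a positive function $g$ and a function $h$ such that $h(\epsilon,\delta)\to0$ as $\delta\to0^+$ for each fixed $\epsilon>0$, and $I(A)\ge g(\epsilon)I(\mathcal Z_\delta(\epsilon)A)-h(\epsilon,\delta)R^d$ for all $\epsilon,\delta,R>0$ and all $A\subset Q(0,R)$. $P$ is boundedly finite if there is a family of finite sets, of uniformly bounded diameter, such that $A$ has $P$ if and only if no member of the family is a subset of $A$. Let $P$ be a boundedly finite supersaturable property. Then there is a measurable set $A$ with property $P$ such that for every non-empty bounded open set $\Omega\subset\mathbb{R}^d$ $$\lim_{t\to\infty}d_{t\cdot\Omega}(A)=m(P).$$ Moreover, the value $m(P)$ does not change if cubes are replaced by Euclidean balls: $\sup\{\limsup_{R\to\infty}d_{B(0,R)}(A): A\text{ has }P\}=m(P)$, where $B(0,R)$ is the ball of radius $R$ centered at $0$. -/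

import Mathlib

open MeasureTheory Filter Topology Set
open scoped Pointwise ENNReal NNReal

noncomputable section

namespace Supersat

/-- Euclidean space of dimension `d`. -/
abbrev E (d : ℕ) : Type := EuclideanSpace ℝ (Fin d)

/-- Lebesgue measurable subsets (equal almost everywhere to a Borel set). -/
abbrev LebMeas {d : ℕ} (A : Set (E d)) : Prop := NullMeasurableSet A volume

/-- A property of Lebesgue measurable sets. Values at other sets are never consulted: every
definition below quantifies over Lebesgue measurable sets only. -/
abbrev SetProperty (d : ℕ) : Type := Set (E d) → Prop

/-- `Q(x, r)`: the open axis-parallel cube with center `x` and side length `r`. -/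
def cube {d : ℕ} (x : E d) (r : ℝ) : Set (E d) := {y | ∀ i, |y i - x i| < r / 2}

/-- `|A ∩ Ω| / |Ω|`: the density of `A` on `Ω`. -/
def density {d : ℕ} (Ω A : Set (E d)) : ℝ := volume.real (A ∩ Ω) / volume.real Ω

/-- Upper density of `A`, measured on the cubes `Q(0, R)`. -/
def upperDensity {d : ℕ} (A : Set (E d)) : ℝ :=
  limsup (fun R : ℝ => density (cube 0 R) A) atTop

/-- Upper density of `A`, measured on the Euclidean balls with center `0` and radius `R`. -/
def ballUpperDensity {d : ℕ} (A : Set (E d)) : ℝ :=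
  limsup (fun R : ℝ => density (Metric.ball 0 R) A) atTop

/-- `m(P)`: the supremum of the upper densities (on cubes) of the sets with property `P`. -/
def maxDensity {d : ℕ} (P : SetProperty d) : ℝ :=
  sSup {a : ℝ | ∃ A : Set (E d), LebMeas A ∧ P A ∧ a = upperDensity A}

/-- The analogue of `m(P)` with densities measured on balls. -/
def ballMaxDensity {d : ℕ} (P : SetProperty d) : ℝ :=
  sSup {a : ℝ | ∃ A : Set (E d), LebMeas A ∧ P A ∧ a = ballUpperDensity A}

/-- The zooming-out operator `Z_δ(ε)`. -/
def zoomOut {d : ℕ} (δ ε : ℝ) (A : Set (E d)) : Set (E d) :=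
  {x | ε * volume.real (cube x δ) < volume.real (cube x δ ∩ A)}

/-- `I` is a saturation function for `P`. -/
structure IsSaturationFunction {d : ℕ} (P : SetProperty d) (I : Set (E d) → ℝ≥0∞) : Prop where
  nontriviality : 0 < maxDensity P
  monotone : ∀ A B : Set (E d), LebMeas A → LebMeas B → B ⊆ A → I B ≤ I A ∧ (P A → P B)
  positivity : ∀ A : Set (E d), LebMeas A → 0 < I A → ¬ P A
  translation : ∀ (A : Set (E d)) (x : E d), LebMeas A →
    I ((fun y => y + x) '' A) = I A ∧ (P ((fun y => y + x) '' A) ↔ P A)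
  locality : ∃ D : ℝ, ∀ A₁ A₂ : Set (E d), LebMeas A₁ → LebMeas A₂ →
    (∀ x ∈ A₁, ∀ y ∈ A₂, D ≤ dist x y) →
      I A₁ + I A₂ ≤ I (A₁ ∪ A₂) ∧ (P (A₁ ∪ A₂) ↔ P A₁ ∧ P A₂)
  zoomability : ∃ ε : ℝ, 0 < ε ∧ ∃ f : ℝ → ℝ≥0, (∀ δ, 0 < δ → 0 < f δ) ∧
    ∀ (δ : ℝ) (A : Set (E d)), 0 < δ → LebMeas A →
      ¬ P (zoomOut δ (1 - ε) A) → (f δ : ℝ≥0∞) ≤ I A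
  zoomingOut : ∃ (g : ℝ → ℝ≥0) (h : ℝ → ℝ → ℝ≥0),
    (∀ ε, 0 < ε → 0 < g ε) ∧
    (∀ ε, 0 < ε → Tendsto (fun δ => h ε δ) (𝓝[>] 0) (𝓝 0)) ∧
    ∀ (ε δ R : ℝ) (A : Set (E d)), 0 < ε → 0 < δ → 0 < R → LebMeas A → A ⊆ cube 0 R →
      (g ε : ℝ≥0∞) * I (zoomOut δ ε A) - h ε δ * ENNReal.ofReal (R ^ d) ≤ I A

/-- `P` is supersaturable: it has a saturation function. -/
def IsSupersaturable {d : ℕ} (P : SetProperty d) : Prop :=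
  ∃ I : Set (E d) → ℝ≥0∞, IsSaturationFunction P I

/-- `P` is boundedly finite: having `P` means containing no member of some family of finite sets
of bounded diameter. -/
def IsBoundedlyFinite {d : ℕ} (P : SetProperty d) : Prop :=
  ∃ F : Set (Finset (E d)),
    (∀ A : Set (E d), LebMeas A → (P A ↔ ∀ X ∈ F, ¬ ((X : Set (E d)) ⊆ A))) ∧
    ∃ ρ : ℝ, ∀ X ∈ F, Metric.diam (X : Set (E d)) ≤ ρ

end Supersat

end

open MeasureTheory Filter Topology Set
open scoped Pointwise ENNReal NNReal

namespace Supersat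

/-! A forbidden finite pattern has diameter at most `ρ`, so pieces with `P` lying more than `ρ`
apart can be glued, even countably many of them. `IsGluable` packages this with heredity and
translation invariance; together with `0 < maxDensity P` it drives the whole argument.

Upper bound: if a set with `P` had density above `m(P) + η` on a large cube, periodic copies of it,
trimmed along the cell faces, would form a set with `P` of upper density above `m(P)`. So at some
scale `s` every set with `P` has density at most `m(P) + η` on all cubes of side `s`
(`exists_cube_bound`), and tiling carries this to the dilates of any bounded open set. Conversely,
averaging over a tiling shows that at each scale some set with `P` has density near `m(P)` on a cube
of that side (`exists_dense_on_cube`).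

To attain `m(P)`, space is tiled by cubes of side `2 ^ n` at distance about `4 ^ n`, each filled
with a near-optimal trimmed piece (`exists_glued`). The sides tend to infinity, so trimming costs
nothing in the limit; relative to the distance they tend to zero, so the cells resolve every `t •
Ω`. Balls are just another choice of `Ω`. -/

/-- `P` is a hereditary translation-invariant property which passes to countable unions of pieces
at distance more than `ρ` from each other. -/
structure IsGluable {d : ℕ} (P : SetProperty d) (ρ : ℝ) : Prop where
  nonneg : 0 ≤ ρ
  mono : ∀ A B : Set (E d), LebMeas A → LebMeas B → B ⊆ A → P A → P B
  trans : ∀ (A : Set (E d)) (x : E d), LebMeas A → P A → P ((fun y => y + x) '' A)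
  glue : ∀ (ι : Type) [Countable ι] (S : ι → Set (E d)), (∀ i, LebMeas (S i)) →
    (∀ i, P (S i)) → (∀ i j, ∀ x ∈ S i, ∀ y ∈ S j, dist x y ≤ ρ → i = j) → P (⋃ i, S i)

theorem exists_isGluable {d : ℕ} {P : SetProperty d} (hsat : IsSupersaturable P)
    (hfin : IsBoundedlyFinite P) (hex : ∃ A, LebMeas A ∧ P A) : ∃ ρ, IsGluable P ρ := by
  obtain ⟨I, hI⟩ := hsat
  obtain ⟨F, hF, ρ, hρ⟩ := hfin
  obtain ⟨A₀, hA₀, hPA₀⟩ := hex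
  refine ⟨max ρ 0, le_max_right _ _, fun A B hA hB h => (hI.monotone A B hA hB h).2,
    fun A x hA => (hI.translation A x hA).2.2, fun ι _ S hS hP hsep => ?_⟩
  refine (hF _ (NullMeasurableSet.iUnion hS)).2 fun X hX hsub => ?_
  -- An empty pattern would lie in every set, so nothing could have `P`; `A₀` excludes this. A point
  -- of `X` is needed to single out one piece.
  have hne : X.Nonempty := by
    refine Finset.nonempty_iff_ne_empty.2 ?_
    rintro rfl
    exact (hF A₀ hA₀).1 hPA₀ _ hX (by simp)
  obtain ⟨x, hx⟩ := hne
  obtain ⟨i, hi⟩ := mem_iUnion.1 (hsub hx)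
  refine (hF _ (hS i)).1 (hP i) X hX fun y hy => ?_
  obtain ⟨j, hj⟩ := mem_iUnion.1 (hsub hy)
  have hxy : dist x y ≤ ρ :=
    (Metric.dist_le_diam_of_mem X.finite_toSet.isBounded hx hy).trans (hρ X hX)
  rwa [hsep i j x hi y hj (hxy.trans (le_max_left _ _))]

/-! ### Densities and lower bounds along dilates -/

theorem volume_real_smul {d : ℕ} {t : ℝ} (ht : 0 ≤ t) (s : Set (E d)) :
    volume.real (t • s) = t ^ d * volume.real s := by
  rw [measureReal_def, Measure.addHaar_smul, ENNReal.toReal_mul, finrank_euclideanSpace_fin,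
    ENNReal.toReal_ofReal (abs_nonneg _), abs_of_nonneg (by positivity), measureReal_def]

theorem volume_real_pos {d : ℕ} {Ω : Set (E d)} (hO : IsOpen Ω) (hB : Bornology.IsBounded Ω)
    (hne : Ω.Nonempty) : 0 < volume.real Ω :=
  ENNReal.toReal_pos (hO.measure_pos volume hne).ne' hB.measure_lt_top.ne

theorem density_nonneg {d : ℕ} (Ω A : Set (E d)) : 0 ≤ density Ω A := by
  unfold density; positivity

theorem density_le_one {d : ℕ} {Ω : Set (E d)} (hB : Bornology.IsBounded Ω) (A : Set (E d)) :
    density Ω A ≤ 1 :=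
  div_le_one_of_le₀ (measureReal_mono inter_subset_right hB.measure_lt_top.ne) (by positivity)

theorem density_compl {d : ℕ} {Ω A : Set (E d)} (hA : LebMeas A) (hB : Bornology.IsBounded Ω)
    (hpos : 0 < volume.real Ω) : density Ω Aᶜ = 1 - density Ω A := by
  have h := measureReal_inter_add_sdiff₀ (μ := volume) (s := Ω) hA hB.measure_lt_top.ne
  have h1 : Aᶜ ∩ Ω = Ω \ A := by rw [inter_comm, sdiff_eq]
  have h2 : A ∩ Ω = Ω ∩ A := inter_comm _ _
  unfold density
  rw [h1, h2, eq_sub_iff_add_eq, ← add_div, add_comm, h, div_self hpos.ne']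

/-- Inside an open set of finite measure there is a compact set that avoids the origin and has
almost full measure. -/
theorem exists_compact_notMem_zero {d : ℕ} (hd : d ≠ 0) {Ω : Set (E d)} (hO : IsOpen Ω)
    (hB : Bornology.IsBounded Ω) {a : ℝ} (ha : a < volume.real Ω) :
    ∃ K ⊆ Ω, IsCompact K ∧ (0 : E d) ∉ K ∧ a ≤ volume.real K := by
  have : Nonempty (Fin d) := ⟨⟨0, Nat.pos_of_ne_zero hd⟩⟩
  have : Nontrivial (E d) := inferInstance
  have hO' : IsOpen (Ω \ {0}) := hO.sdiff isClosed_singleton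
  have hvol : volume (Ω \ {(0 : E d)}) = volume Ω := measure_sdiff_null (measure_singleton _)
  rcases lt_or_ge a 0 with h0 | h0
  -- A negative `a` does occur: the intended value `(1 - η / θ) * volume.real Ω` is negative when `η
  -- > θ`.
  · exact ⟨∅, empty_subset _, isCompact_empty, notMem_empty _, by simpa using h0.le⟩
  have hlt : ENNReal.ofReal a < volume (Ω \ {(0 : E d)}) := by
    rw [hvol]
    exact (ENNReal.ofReal_lt_iff_lt_toReal h0 hB.measure_lt_top.ne).2 ha
  obtain ⟨K, hK, hKc, hlt⟩ := hO'.exists_lt_isCompact hlt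
  refine ⟨K, fun x hx => (hK hx).1, hKc, fun h => (hK h).2 rfl, ?_⟩
  exact ((ENNReal.ofReal_lt_iff_lt_toReal h0 hKc.measure_lt_top.ne).1 hlt).le

/-- If the far cells of a countable partition are small compared to their distance from the
origin, and `A` has density at least `θ` on each of them, then `A` has lower density at least `θ`
along the dilates of every bounded open set. -/
theorem eventually_le_density {d : ℕ} (hd : d ≠ 0) {ι : Type*} [Countable ι] {c : E d → ι}
    (hmeas : ∀ x, MeasurableSet (c ⁻¹' {c x}))
    (hsmall : ∀ γ > 0, ∀ᶠ x in Bornology.cobounded (E d), ∀ y, c y = c x → dist y x ≤ γ * ‖x‖)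
    {A : Set (E d)} (hA : LebMeas A) {θ : ℝ}
    (hθ : ∀ᶠ x in Bornology.cobounded (E d),
      ENNReal.ofReal θ * volume (c ⁻¹' {c x}) ≤ volume (A ∩ c ⁻¹' {c x}))
    {Ω : Set (E d)} (hO : IsOpen Ω) (hB : Bornology.IsBounded Ω) (hne : Ω.Nonempty)
    {η : ℝ} (hη : 0 < η) : ∀ᶠ t : ℝ in atTop, θ - η ≤ density (t • Ω) A := by
  rcases le_or_gt θ 0 with h0 | h0
  · exact Eventually.of_forall fun t => by linarith [density_nonneg (t • Ω) A]
  have hpos := volume_real_pos hO hB hne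
  -- Losing the fraction `η / θ` of `Ω` costs exactly `η` in density. Since `K` avoids the origin,
  -- `t • K` moves uniformly to infinity.
  obtain ⟨K, hKΩ, hKc, hK0, hK⟩ := exists_compact_notMem_zero hd hO hB
    (a := (1 - η / θ) * volume.real Ω) (by nlinarith [mul_pos (div_pos hη h0) hpos])
  obtain ⟨δ, hδ, hδΩ⟩ := hKc.exists_thickening_subset_open hO hKΩ
  obtain ⟨r, hr, hrK⟩ : ∃ r > 0, ∀ x ∈ K, r ≤ ‖x‖ := by
    obtain ⟨r, hr, h⟩ := Metric.isOpen_iff.1 hKc.isClosed.isOpen_compl 0 hK0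
    refine ⟨r, hr, fun x hx => not_lt.1 fun hlt => h ?_ hx⟩
    simpa using hlt
  obtain ⟨M, hM, hMK⟩ : ∃ M > 0, ∀ x ∈ K, ‖x‖ ≤ M := by
    obtain ⟨M, hM⟩ := hKc.isBounded.exists_norm_le
    exact ⟨max M 1, by positivity, fun x hx => (hM x hx).trans (le_max_left _ _)⟩
  -- With this ratio a cell meeting `t • K` reaches at most `t * δ / 2` away, hence stays in the
  -- `δ`-thickening of `K` scaled by `t`.
  have hev := (hsmall (δ / (2 * M)) (by positivity)).and hθ
  obtain ⟨r₀, -, hr₀⟩ := (Metric.hasBasis_cobounded_compl_closedBall (0 : E d)).eventually_iff.1 hev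
  filter_upwards [eventually_gt_atTop 0, eventually_gt_atTop (r₀ / r)] with t ht htr
  have hfar : ∀ x ∈ t • K, (∀ y, c y = c x → dist y x ≤ δ / (2 * M) * ‖x‖) ∧
      ENNReal.ofReal θ * volume (c ⁻¹' {c x}) ≤ volume (A ∩ c ⁻¹' {c x}) := by
    rintro _ ⟨x, hx, rfl⟩
    refine hr₀ ?_
    have h1 : r₀ < t * r := (div_lt_iff₀ hr).1 htr
    have h2 : t * r ≤ t * ‖x‖ := by gcongr; exact hrK x hx
    simp only [mem_compl_iff, mem_closedBall_zero_iff, norm_smul, Real.norm_eq_abs, abs_of_pos ht,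
      not_le]
    linarith
  have hsub : ∀ x ∈ t • K, c ⁻¹' {c x} ⊆ t • Ω := by
    intro x hx y hy
    have hd := (hfar x hx).1 y hy
    obtain ⟨k, hk, rfl⟩ := hx
    refine (mem_smul_set_iff_inv_smul_mem₀ ht.ne' _ _).2 (hδΩ ?_)
    refine Metric.mem_thickening_iff.2 ⟨k, hk, ?_⟩
    have h1 : dist (t⁻¹ • y) k = t⁻¹ * dist y (t • k) := by
      conv_lhs => rw [← inv_smul_smul₀ ht.ne' k]
      rw [dist_smul₀, Real.norm_eq_abs, abs_of_pos (inv_pos.2 ht)]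
    have h2 : dist y (t • k) ≤ t * (δ / 2) := by
      refine hd.trans ?_
      simp only [norm_smul, Real.norm_eq_abs, abs_of_pos ht]
      calc δ / (2 * M) * (t * ‖k‖) ≤ δ / (2 * M) * (t * M) := by gcongr; exact hMK k hk
        _ = t * (δ / 2) := by field_simp
    rw [h1, inv_mul_lt_iff₀ ht]
    nlinarith
  set J : Set ι := c '' (t • K)
  have hJ : ∀ i ∈ J, MeasurableSet (c ⁻¹' {i}) ∧ c ⁻¹' {i} ⊆ t • Ω ∧
      ENNReal.ofReal θ * volume (c ⁻¹' {i}) ≤ volume (A ∩ c ⁻¹' {i}) := by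
    rintro _ ⟨x, hx, rfl⟩
    exact ⟨hmeas x, hsub x hx, (hfar x hx).2⟩
  have hdisj : J.PairwiseDisjoint fun i => c ⁻¹' {i} := fun i _ j _ hij =>
    Disjoint.preimage c (disjoint_singleton.2 hij)
  have hmain : ENNReal.ofReal θ * volume (t • K) ≤ volume (A ∩ t • Ω) := by
    calc ENNReal.ofReal θ * volume (t • K)
        ≤ ENNReal.ofReal θ * volume (⋃ i ∈ J, c ⁻¹' {i}) := by
          gcongr
          exact fun x hx => mem_biUnion (mem_image_of_mem c hx) rfl
      _ = ∑' i : J, ENNReal.ofReal θ * volume (c ⁻¹' {(i : ι)}) := by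
          rw [measure_biUnion J.to_countable hdisj fun i hi => (hJ i hi).1, ENNReal.tsum_mul_left]
      _ ≤ ∑' i : J, volume (A ∩ c ⁻¹' {(i : ι)}) :=
          ENNReal.tsum_le_tsum fun i => (hJ i i.2).2.2
      _ = volume (⋃ i ∈ J, A ∩ c ⁻¹' {i}) := by
          refine (measure_biUnion₀ (f := fun i => A ∩ c ⁻¹' {i}) J.to_countable ?_
            fun i hi => ?_).symm
          · exact fun i hi j hj hij =>
              ((hdisj hi hj hij).mono inter_subset_right inter_subset_right).aedisjoint
          · exact hA.inter (hJ i hi).1.nullMeasurableSet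
      _ ≤ volume (A ∩ t • Ω) := by
          refine measure_mono (iUnion₂_subset fun i hi => ?_)
          exact inter_subset_inter_right _ (hJ i hi).2.1
  have hfin : volume (A ∩ t • Ω) ≠ ⊤ :=
    (measure_mono inter_subset_right).trans_lt (hB.smul₀ t).measure_lt_top |>.ne
  have hreal := ENNReal.toReal_mono hfin hmain
  rw [ENNReal.toReal_mul, ENNReal.toReal_ofReal h0.le, ← measureReal_def, ← measureReal_def,
    volume_real_smul ht.le] at hreal
  unfold density
  rw [volume_real_smul ht.le, le_div_iff₀ (by positivity)]
  refine le_trans (le_of_eq ?_) ((mul_le_mul_of_nonneg_left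
    (mul_le_mul_of_nonneg_left hK (by positivity)) h0.le).trans hreal)
  field_simp

/-- The upper bound dual to `eventually_le_density`. -/
theorem eventually_density_le {d : ℕ} (hd : d ≠ 0) {ι : Type*} [Countable ι] {c : E d → ι}
    (hmeas : ∀ x, MeasurableSet (c ⁻¹' {c x}))
    (hfin : ∀ x, volume (c ⁻¹' {c x}) ≠ ⊤)
    (hsmall : ∀ γ > 0, ∀ᶠ x in Bornology.cobounded (E d), ∀ y, c y = c x → dist y x ≤ γ * ‖x‖)
    {A : Set (E d)} (hA : LebMeas A) {θ : ℝ}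
    (hθ : ∀ x, volume.real (A ∩ c ⁻¹' {c x}) ≤ θ * volume.real (c ⁻¹' {c x}))
    {Ω : Set (E d)} (hO : IsOpen Ω) (hB : Bornology.IsBounded Ω) (hne : Ω.Nonempty)
    {η : ℝ} (hη : 0 < η) : ∀ᶠ t : ℝ in atTop, density (t • Ω) A ≤ θ + η := by
  -- The complement has density at least `1 - θ` on every cell.
  have key := eventually_le_density hd hmeas hsmall hA.compl (θ := 1 - θ) ?_ hO hB hne hη
  · filter_upwards [key, eventually_gt_atTop 0] with t h ht
    rw [density_compl hA (hB.smul₀ t)] at h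
    · linarith
    · rw [volume_real_smul ht.le]
      have := volume_real_pos hO hB hne
      positivity
  · refine Eventually.of_forall fun x => ?_
    have h := measureReal_inter_add_sdiff₀ (μ := volume) (s := c ⁻¹' {c x}) hA (hfin x)
    have h1 : Aᶜ ∩ c ⁻¹' {c x} = c ⁻¹' {c x} \ A := by rw [inter_comm, sdiff_eq]
    have h2 := hθ x
    rw [inter_comm] at h2
    rw [h1, ← ENNReal.ofReal_toReal (hfin x), ← ENNReal.ofReal_mul' ENNReal.toReal_nonneg,
      ← measureReal_def]
    refine ENNReal.ofReal_le_of_le_toReal ?_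
    rw [← measureReal_def]
    linarith

/-! ### Lattice cells and gluing -/

/-- The half-open cube `[0, s)ᵈ`. -/
def cornerCube (d : ℕ) (s : ℝ) : Set (E d) := {y | ∀ j, y j ∈ Ico 0 s}

/-- The open cube obtained from `[0, s)ᵈ` by removing a margin of width `ρ`. -/
def innerCube (d : ℕ) (ρ s : ℝ) : Set (E d) := {y | ∀ j, y j ∈ Ioo ρ (s - ρ)}

/-- The lattice point `s z`. -/
def latticePoint {d : ℕ} (s : ℝ) (z : Fin d → ℤ) : E d := WithLp.toLp 2 fun j => s * z j

/-- The cell of a tiling by lattice cubes whose side at `x` is `side (lev x)`. -/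
noncomputable def cell {d : ℕ} (lev : E d → ℕ) (side : ℕ → ℝ) (x : E d) : ℕ × (Fin d → ℤ) :=
  (lev x, fun j => ⌊x j / side (lev x)⌋)

theorem cornerCube_eq {d : ℕ} (s : ℝ) : cornerCube d s =
    WithLp.ofLp ⁻¹' (Set.univ.pi fun _ : Fin d => Ico (0 : ℝ) s) := by
  ext y; simp [cornerCube]

theorem innerCube_eq {d : ℕ} (ρ s : ℝ) : innerCube d ρ s =
    WithLp.ofLp ⁻¹' (Set.univ.pi fun _ : Fin d => Ioo ρ (s - ρ)) := by
  ext y; simp [innerCube]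

theorem measurableSet_cornerCube {d : ℕ} (s : ℝ) : MeasurableSet (cornerCube d s) := by
  rw [cornerCube_eq]
  exact (PiLp.volume_preserving_ofLp (Fin d)).measurable
    (MeasurableSet.univ_pi fun _ => measurableSet_Ico)

theorem measurableSet_innerCube {d : ℕ} (ρ s : ℝ) : MeasurableSet (innerCube d ρ s) := by
  rw [innerCube_eq]
  exact (PiLp.volume_preserving_ofLp (Fin d)).measurable
    (MeasurableSet.univ_pi fun _ => measurableSet_Ioo)

theorem volume_cornerCube {d : ℕ} (s : ℝ) :
    volume (cornerCube d s) = ENNReal.ofReal s ^ d := by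
  rw [cornerCube_eq, (PiLp.volume_preserving_ofLp (Fin d)).measure_preimage
    (MeasurableSet.univ_pi fun _ => measurableSet_Ico).nullMeasurableSet, Real.volume_pi_Ico]
  simp

theorem volume_innerCube {d : ℕ} (ρ s : ℝ) :
    volume (innerCube d ρ s) = ENNReal.ofReal (s - ρ - ρ) ^ d := by
  rw [innerCube_eq, (PiLp.volume_preserving_ofLp (Fin d)).measure_preimage
    (MeasurableSet.univ_pi fun _ => measurableSet_Ioo).nullMeasurableSet, Real.volume_pi_Ioo]
  simp

theorem innerCube_subset {d : ℕ} {ρ : ℝ} (hρ : 0 ≤ ρ) (s : ℝ) :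
    innerCube d ρ s ⊆ cornerCube d s := fun y hy j =>
  ⟨hρ.trans (hy j).1.le, by linarith [(hy j).2]⟩

/-- Removing the margin costs at most the measure of the margin. -/
theorem volume_inter_innerCube_ge {d : ℕ} {ρ s : ℝ} (hρ : 0 ≤ ρ) (hs : 2 * ρ ≤ s)
    (B : Set (E d)) :
    volume.real (B ∩ cornerCube d s) - (s ^ d - (s - ρ - ρ) ^ d)
      ≤ volume.real (B ∩ innerCube d ρ s) := by
  have hC : volume (cornerCube d s) ≠ ⊤ := by
    rw [volume_cornerCube]; exact ENNReal.pow_ne_top ENNReal.ofReal_ne_top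
  have hI : volume (innerCube d ρ s) ≠ ⊤ := by
    rw [volume_innerCube]; exact ENNReal.pow_ne_top ENNReal.ofReal_ne_top
  have h1 : volume.real (cornerCube d s \ innerCube d ρ s) = s ^ d - (s - ρ - ρ) ^ d := by
    rw [measureReal_sdiff (innerCube_subset hρ s) (measurableSet_innerCube ρ s) hC,
      measureReal_def, measureReal_def, volume_cornerCube, volume_innerCube]
    simp only [ENNReal.toReal_pow]
    rw [ENNReal.toReal_ofReal (by linarith), ENNReal.toReal_ofReal (by linarith)]
  rw [← h1, sub_le_iff_le_add]
  refine (measureReal_mono (fun x hx => ?_) ?_).trans (measureReal_union_le _ _)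
  · by_cases h : x ∈ innerCube d ρ s
    · exact Or.inl ⟨hx.1, h⟩
    · exact Or.inr ⟨hx.2, h⟩
  · exact ((measure_union_le _ _).trans_lt (ENNReal.add_lt_top.2
      ⟨(measure_mono inter_subset_right).trans_lt hI.lt_top,
        (measure_mono sdiff_subset).trans_lt hC.lt_top⟩)).ne

theorem mem_translate_cornerCube {d : ℕ} {s : ℝ} (hs : 0 < s) (z : Fin d → ℤ) (y : E d) :
    y ∈ (fun y => y + latticePoint s z) '' cornerCube d s ↔ ∀ j, ⌊y j / s⌋ = z j := by
  rw [image_add_right]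
  refine forall_congr' fun j => ?_
  rw [Int.floor_eq_iff, le_div_iff₀ hs, div_lt_iff₀ hs]
  simp only [latticePoint, mem_Ico, PiLp.add_apply, PiLp.neg_apply]
  constructor <;> rintro ⟨h1, h2⟩ <;> constructor <;> linarith

/-- `hlev` makes the level constant on each lattice cube of the side it prescribes, so cubes of
different sizes never cut one another. -/
theorem cell_fiber {d : ℕ} {lev : E d → ℕ} {side : ℕ → ℝ} (hside : ∀ n, 0 < side n)
    (hlev : ∀ x y : E d, (∀ j, ⌊y j / side (lev x)⌋ = ⌊x j / side (lev x)⌋) → lev y = lev x)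
    (x : E d) : cell lev side ⁻¹' {cell lev side x} =
      (fun y => y + latticePoint (side (lev x)) (cell lev side x).2) ''
        cornerCube d (side (lev x)) := by
  ext y
  rw [mem_translate_cornerCube (hside _)]
  simp only [cell, mem_preimage, mem_singleton_iff, Prod.mk.injEq, funext_iff]
  constructor
  · rintro ⟨h1, h2⟩ j
    simpa [h1] using h2 j
  · intro h
    have h1 := hlev x y h
    exact ⟨h1, by simpa [h1] using h⟩

theorem volume_translate {d : ℕ} (S : Set (E d)) (p : E d) :
    volume ((fun y => y + p) '' S) = volume S := by
  rw [image_add_right, measure_preimage_add_right]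

theorem lebMeas_translate {d : ℕ} {S : Set (E d)} (hS : LebMeas S) (p : E d) :
    LebMeas ((fun y => y + p) '' S) := by
  rw [image_add_right]
  exact NullMeasurableSet.preimage hS (measurePreserving_add_right volume _).quasiMeasurePreserving

theorem measurableSet_cell_fiber {d : ℕ} {lev : E d → ℕ} {side : ℕ → ℝ}
    (hside : ∀ n, 0 < side n)
    (hlev : ∀ x y : E d, (∀ j, ⌊y j / side (lev x)⌋ = ⌊x j / side (lev x)⌋) → lev y = lev x)
    (x : E d) : MeasurableSet (cell lev side ⁻¹' {cell lev side x}) := by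
  rw [cell_fiber hside hlev, image_add_right]
  exact measurable_add_const _ (measurableSet_cornerCube _)

theorem volume_cell_fiber {d : ℕ} {lev : E d → ℕ} {side : ℕ → ℝ}
    (hside : ∀ n, 0 < side n)
    (hlev : ∀ x y : E d, (∀ j, ⌊y j / side (lev x)⌋ = ⌊x j / side (lev x)⌋) → lev y = lev x)
    (x : E d) : volume (cell lev side ⁻¹' {cell lev side x}) =
      ENNReal.ofReal (side (lev x) ^ d) := by
  rw [cell_fiber hside hlev, volume_translate, volume_cornerCube,
    ENNReal.ofReal_pow (hside _).le]

theorem dist_le_of_cell_eq {d : ℕ} {lev : E d → ℕ} {side : ℕ → ℝ}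
    (hside : ∀ n, 0 < side n) {x y : E d} (h : cell lev side y = cell lev side x) :
    dist y x ≤ √d * side (lev x) := by
  have hs := hside (lev x)
  simp only [cell, Prod.mk.injEq, funext_iff] at h
  obtain ⟨h1, h2⟩ := h
  rw [h1] at h2
  have h3 : ∀ j, dist (y j) (x j) ≤ side (lev x) := fun j => by
    have := Int.abs_sub_lt_one_of_floor_eq_floor (h2 j)
    rw [← sub_div, abs_div, abs_of_pos hs, div_lt_one hs] at this
    exact this.le
  rw [EuclideanSpace.dist_eq, ← Real.sqrt_sq hs.le, ← Real.sqrt_mul (Nat.cast_nonneg d)]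
  refine Real.sqrt_le_sqrt ?_
  calc ∑ j, dist (y j) (x j) ^ 2 ≤ ∑ _j : Fin d, side (lev x) ^ 2 := by
        gcongr with j; exact h3 j
    _ = d * side (lev x) ^ 2 := by simp

/-- Filling every cell of a lattice tiling by a translate of a piece with property `P`, shrunken
so that different pieces stay apart. -/
theorem exists_glued {d : ℕ} {P : SetProperty d} {ρ : ℝ} (hP : IsGluable P ρ)
    {lev : E d → ℕ} {side : ℕ → ℝ} (hside : ∀ n, 0 < side n)
    (hlev : ∀ x y : E d, (∀ j, ⌊y j / side (lev x)⌋ = ⌊x j / side (lev x)⌋) → lev y = lev x)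
    {B : ℕ → Set (E d)} (hB : ∀ n, LebMeas (B n)) (hPB : ∀ n, P (B n)) :
    ∃ A : Set (E d), LebMeas A ∧ P A ∧ ∀ x,
      volume (B (lev x) ∩ innerCube d ρ (side (lev x))) ≤
        volume (A ∩ cell lev side ⁻¹' {cell lev side x}) := by
  -- Only pairs in the range of `cell` are genuine cells; an arbitrary level and lattice index may
  -- name a cube lying elsewhere in the tiling.
  let S : range (cell lev side) → Set (E d) := fun i =>
    (fun y => y + latticePoint (side i.1.1) i.1.2) ''
      (B i.1.1 ∩ innerCube d ρ (side i.1.1))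
  have hBI : ∀ n, LebMeas (B n ∩ innerCube d ρ (side n)) := fun n =>
    (hB n).inter (measurableSet_innerCube _ _).nullMeasurableSet
  have hSm : ∀ i, LebMeas (S i) := fun i => lebMeas_translate (hBI _) _
  have hSP : ∀ i, P (S i) := fun i => hP.trans _ _ (hBI _)
    (hP.mono _ _ (hB _) (hBI _) inter_subset_left (hPB _))
  have hSc : ∀ i, ∀ y ∈ S i, cell lev side y = i := by
    rintro ⟨_, x, rfl⟩ y hy
    have : y ∈ cell lev side ⁻¹' {cell lev side x} := by
      rw [cell_fiber hside hlev]
      exact image_mono (inter_subset_right.trans (innerCube_subset hP.nonneg _)) hy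
    exact this
  refine ⟨⋃ i, S i, NullMeasurableSet.iUnion hSm,
    hP.glue _ S hSm hSP ?_, fun x => ?_⟩
  · intro i j x hx y hy hxy
    -- A point of a trimmed piece is more than `ρ` from each face of its cell, so a point within `ρ`
    -- of it is still in that cell.
    suffices h : cell lev side y = i from Subtype.ext (h.symm.trans (hSc j y hy))
    obtain ⟨_, w, rfl⟩ := i
    suffices h : y ∈ cell lev side ⁻¹' {cell lev side w} from h
    rw [cell_fiber hside hlev, image_add_right]
    intro k
    obtain ⟨u, ⟨-, hu⟩, rfl⟩ := hx
    have h1 := (PiLp.dist_apply_le (u + latticePoint (side (lev w)) (cell lev side w).2) y k).trans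
      hxy
    rw [Real.dist_eq, abs_le] at h1
    have h2 := hu k
    simp only [cell, latticePoint, mem_Ico, mem_Ioo, PiLp.add_apply, PiLp.neg_apply] at h1 h2 ⊢
    constructor <;> linarith
  · have h : S ⟨cell lev side x, x, rfl⟩ ⊆ (⋃ i, S i) ∩ cell lev side ⁻¹' {cell lev side x} :=
      fun y hy => ⟨mem_iUnion.2 ⟨_, hy⟩, hSc _ y hy⟩
    refine le_trans (le_of_eq ?_) (measure_mono h)
    exact (volume_translate _ _).symm

/-! ### Upper densities and the maximal density -/

theorem isOpen_cube {d : ℕ} (x : E d) (r : ℝ) : IsOpen (cube x r) := by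
  have : cube x r = ⋂ i, {y : E d | |y i - x i| < r / 2} := by ext; simp [cube]
  rw [this]
  exact isOpen_iInter_of_finite fun i => isOpen_lt (by fun_prop) continuous_const

theorem isBounded_cube {d : ℕ} (x : E d) (r : ℝ) : Bornology.IsBounded (cube x r) := by
  refine (Metric.isBounded_closedBall (x := x) (r := √(∑ _i : Fin d, (r / 2) ^ 2))).subset
    fun y hy => ?_
  rw [Metric.mem_closedBall, EuclideanSpace.dist_eq]
  refine Real.sqrt_le_sqrt (Finset.sum_le_sum fun i _ => ?_)
  rw [Real.dist_eq]
  exact pow_le_pow_left₀ (abs_nonneg _) (hy i).le 2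

theorem smul_unit_cube {d : ℕ} {t : ℝ} (ht : 0 < t) : t • cube (0 : E d) 1 = cube 0 t := by
  ext y
  rw [mem_smul_set_iff_inv_smul_mem₀ ht.ne']
  refine forall_congr' fun i => ?_
  simp only [PiLp.smul_apply, PiLp.zero_apply, sub_zero, smul_eq_mul, abs_mul, abs_inv,
    abs_of_pos ht]
  rw [inv_mul_lt_iff₀ ht]
  ring_nf

theorem upperDensity_eq {d : ℕ} (A : Set (E d)) :
    upperDensity A = limsup (fun t : ℝ => density (t • cube 0 1) A) atTop :=
  limsup_congr <| (eventually_gt_atTop 0).mono fun t ht => by rw [smul_unit_cube ht]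

theorem ballUpperDensity_eq {d : ℕ} (A : Set (E d)) :
    ballUpperDensity A = limsup (fun t : ℝ => density (t • Metric.ball 0 1) A) atTop :=
  limsup_congr <| (eventually_gt_atTop 0).mono fun t ht => by
    rw [smul_unitBall_of_pos ht]

theorem isBoundedUnder_density {d : ℕ} {Ω : Set (E d)} (hB : Bornology.IsBounded Ω)
    (A : Set (E d)) : IsBoundedUnder (· ≤ ·) atTop fun t : ℝ => density (t • Ω) A :=
  isBoundedUnder_of ⟨1, fun t => density_le_one (hB.smul₀ t) A⟩

theorem isCoboundedUnder_density {d : ℕ} (Ω A : Set (E d)) :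
    IsCoboundedUnder (· ≤ ·) atTop fun t : ℝ => density (t • Ω) A :=
  IsBoundedUnder.isCoboundedUnder_le (isBoundedUnder_of ⟨0, fun _ => density_nonneg _ A⟩)

theorem le_maxDensity {d : ℕ} {P : SetProperty d} {A : Set (E d)} (hA : LebMeas A) (hP : P A)
    {a : ℝ} (h : ∀ᶠ t : ℝ in atTop, a ≤ density (t • cube 0 1) A) : a ≤ maxDensity P := by
  have h1 : a ≤ upperDensity A := by
    rw [upperDensity_eq]
    exact le_limsup_of_frequently_le h.frequently (isBoundedUnder_density (isBounded_cube _ _) A)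
  refine h1.trans (le_csSup ⟨1, ?_⟩ ⟨A, hA, hP, rfl⟩)
  rintro _ ⟨B, -, -, rfl⟩
  rw [upperDensity_eq]
  exact limsup_le_of_le (isCoboundedUnder_density _ _)
    (Eventually.of_forall fun t => density_le_one ((isBounded_cube _ _).smul₀ t) B)

theorem zero_mem_cube {d : ℕ} : (0 : E d) ∈ cube (0 : E d) 1 := fun i => by simp

/-- The real supremum of the empty set is `0` by convention. -/
theorem exists_of_maxDensity_pos {d : ℕ} {P : SetProperty d} (h : 0 < maxDensity P) :
    ∃ A, LebMeas A ∧ P A := by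
  by_contra! hcon
  have : {a : ℝ | ∃ A : Set (E d), LebMeas A ∧ P A ∧ a = upperDensity A} = ∅ := by
    ext a
    simp only [mem_ofPred_eq, mem_empty_iff_false, iff_false]
    rintro ⟨A, hA, hPA, -⟩
    exact hcon A hA hPA
  rw [maxDensity, this, Real.sSup_empty] at h
  exact h.false

/-! ### Comparing density on one cube with `m(P)` -/

/-- The proportion of a cube of side `s` taken by a margin of width `ρ`. -/
noncomputable def marginRatio (d : ℕ) (ρ s : ℝ) : ℝ := 1 - (1 - 2 * ρ / s) ^ d

theorem tendsto_marginRatio (d : ℕ) (ρ : ℝ) : Tendsto (marginRatio d ρ) atTop (𝓝 0) := by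
  have h : Tendsto (fun s : ℝ => 1 - (1 - 2 * ρ / s) ^ d) atTop (𝓝 (1 - (1 - 0) ^ d)) :=
    ((tendsto_const_nhds.sub (tendsto_const_nhds.div_atTop tendsto_id)).pow d).const_sub 1
  rw [sub_zero, one_pow, sub_self] at h
  exact h

/-- A piece of density at least `a` on a cube keeps most of it off the margin. -/
theorem le_volume_inter_innerCube {d : ℕ} {ρ s a : ℝ} (hρ : 0 ≤ ρ) (hs0 : 0 < s)
    (hs : 2 * ρ ≤ s) {B : Set (E d)} (hB : a * s ^ d ≤ volume.real (B ∩ cornerCube d s)) :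
    ENNReal.ofReal (a - marginRatio d ρ s) * ENNReal.ofReal (s ^ d) ≤
      volume (B ∩ innerCube d ρ s) := by
  rw [← ENNReal.ofReal_mul' (by positivity)]
  refine ENNReal.ofReal_le_of_le_toReal ?_
  rw [← measureReal_def]
  refine le_trans (le_of_eq ?_) ((sub_le_sub_right hB _).trans
    (volume_inter_innerCube_ge hρ hs B))
  have h : (s - ρ - ρ) ^ d = (1 - 2 * ρ / s) ^ d * s ^ d := by
    rw [← mul_pow]; congr 1; field_simp; ring
  rw [h, marginRatio]
  ring

theorem eventually_uniform_cells_small {d : ℕ} {s : ℝ} (hs : 0 < s) :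
    ∀ γ > 0, ∀ᶠ x in Bornology.cobounded (E d), ∀ y,
      cell (fun _ => 0) (fun _ => s) y = cell (fun _ => 0) (fun _ => s) x →
        dist y x ≤ γ * ‖x‖ := by
  intro γ hγ
  filter_upwards [tendsto_norm_cobounded_atTop.eventually_ge_atTop (√d * s / γ)] with x hx y hy
  refine (dist_le_of_cell_eq (fun _ => hs) hy).trans ?_
  rwa [div_le_iff₀' hγ] at hx

/-- If sets with `P` have density at most `θ` on cubes of some side `s`, then they have density at
most `θ` asymptotically. -/
theorem eventually_density_le_of_cube {d : ℕ} (hd : d ≠ 0) {P : SetProperty d} {ρ : ℝ}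
    (hP : IsGluable P ρ) {s θ : ℝ} (hs : 0 < s)
    (h : ∀ B, LebMeas B → P B → volume.real (B ∩ cornerCube d s) ≤ θ * s ^ d)
    {A : Set (E d)} (hA : LebMeas A) (hPA : P A)
    {Ω : Set (E d)} (hO : IsOpen Ω) (hB : Bornology.IsBounded Ω) (hne : Ω.Nonempty)
    {η : ℝ} (hη : 0 < η) : ∀ᶠ t : ℝ in atTop, density (t • Ω) A ≤ θ + η := by
  have hside : ∀ _ : ℕ, 0 < s := fun _ => hs
  have hlev : ∀ x y : E d, (∀ j, ⌊y j / s⌋ = ⌊x j / s⌋) → 0 = 0 := fun _ _ _ => rfl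
  refine eventually_density_le hd (c := cell (fun _ => 0) (fun _ => s))
    (measurableSet_cell_fiber hside hlev) (fun x => ?_) (eventually_uniform_cells_small hs)
    hA (fun x => ?_) hO hB hne hη
  · rw [volume_cell_fiber hside hlev]; exact ENNReal.ofReal_ne_top
  · have h1 : volume.real (cell (fun _ => 0) (fun _ => s) ⁻¹'
        {cell (fun _ => 0) (fun _ => s) x}) = s ^ d := by
      rw [measureReal_def, volume_cell_fiber hside hlev, ENNReal.toReal_ofReal (by positivity)]
    rw [h1, cell_fiber hside hlev]
    set p := latticePoint s (cell (fun _ => 0) (fun _ => s) x).2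
    -- Pulling the cell back to the corner cube replaces `A` by a translate, which still has `P`.
    have h2 : A ∩ (fun y => y + p) '' cornerCube d s =
        (fun y => y + p) '' ((fun y => y + -p) '' A ∩ cornerCube d s) := by
      rw [image_inter (add_left_injective p), image_image]
      simp
    rw [h2, measureReal_def, volume_translate, ← measureReal_def]
    exact h _ (lebMeas_translate hA _) (hP.trans _ _ hA hPA)

/-- Otherwise averaging over the tiling of side `s` would bound every upper density by `θ` plus half
the gap to `m(P)`. -/
theorem exists_dense_on_cube {d : ℕ} (hd : d ≠ 0) {P : SetProperty d} {ρ : ℝ}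
    (hP : IsGluable P ρ) (hm : 0 < maxDensity P) {s θ : ℝ} (hs : 0 < s)
    (hθ : θ < maxDensity P) :
    ∃ B, LebMeas B ∧ P B ∧ θ * s ^ d ≤ volume.real (B ∩ cornerCube d s) := by
  by_contra! hcon
  obtain ⟨A₀, hA₀, hPA₀⟩ := exists_of_maxDensity_pos hm
  have : maxDensity P ≤ θ + (maxDensity P - θ) / 2 := by
    refine csSup_le ⟨_, A₀, hA₀, hPA₀, rfl⟩ ?_
    rintro _ ⟨A, hA, hPA, rfl⟩
    rw [upperDensity_eq]
    exact limsup_le_of_le (isCoboundedUnder_density _ _)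
      (eventually_density_le_of_cube hd hP hs (fun B hB hPB => (hcon B hB hPB).le) hA hPA
        (isOpen_cube _ _) (isBounded_cube _ _) ⟨0, zero_mem_cube⟩ (by linarith))
  linarith

/-- A violating piece, repeated periodically, would beat `m(P)`: of its excess `η`, the margin takes
less than `η / 2` and the passage to dilates `η / 4`. -/
theorem exists_cube_bound {d : ℕ} (hd : d ≠ 0) {P : SetProperty d} {ρ : ℝ}
    (hP : IsGluable P ρ) {η : ℝ} (hη : 0 < η) : ∃ s, 0 < s ∧ ∀ B, LebMeas B → P B →
      volume.real (B ∩ cornerCube d s) ≤ (maxDensity P + η) * s ^ d := by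
  obtain ⟨s, hκ, hs, hs0⟩ := (((tendsto_marginRatio d ρ).eventually_lt_const (half_pos hη)).and
    ((eventually_ge_atTop (2 * ρ)).and (eventually_gt_atTop 0))).exists
  refine ⟨s, hs0, fun B hB hPB => ?_⟩
  by_contra! hcon
  have hside : ∀ _ : ℕ, 0 < s := fun _ => hs0
  have hlev : ∀ x y : E d, (∀ j, ⌊y j / s⌋ = ⌊x j / s⌋) → 0 = 0 := fun _ _ _ => rfl
  obtain ⟨A, hA, hPA, hAB⟩ := exists_glued hP hside hlev (B := fun _ => B) (fun _ => hB)
    (fun _ => hPB)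
  have h1 := eventually_le_density hd (measurableSet_cell_fiber hside hlev)
    (eventually_uniform_cells_small hs0) hA
    (θ := maxDensity P + η - marginRatio d ρ s)
    (Eventually.of_forall fun x => ?_) (isOpen_cube 0 1) (isBounded_cube 0 1)
    ⟨0, zero_mem_cube⟩ (η := η / 4) (by linarith)
  · linarith [le_maxDensity hA hPA h1]
  · rw [volume_cell_fiber hside hlev]
    exact (le_volume_inter_innerCube hP.nonneg hs0 hs hcon.le).trans (hAB x)

/-- Sets with `P` have density at most `m(P)` asymptotically along the dilates of every bounded
open set. -/
theorem eventually_density_le_maxDensity {d : ℕ} (hd : d ≠ 0) {P : SetProperty d} {ρ : ℝ}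
    (hP : IsGluable P ρ) {A : Set (E d)} (hA : LebMeas A) (hPA : P A)
    {Ω : Set (E d)} (hO : IsOpen Ω) (hB : Bornology.IsBounded Ω) (hne : Ω.Nonempty)
    {η : ℝ} (hη : 0 < η) : ∀ᶠ t : ℝ in atTop, density (t • Ω) A ≤ maxDensity P + η := by
  obtain ⟨s, hs, h⟩ := exists_cube_bound hd hP (half_pos hη)
  filter_upwards [eventually_density_le_of_cube hd hP hs h hA hPA hO hB hne (half_pos hη)]
    with t ht
  linarith

/-! ### The multiscale tiling and its extremal set -/

/-- The half-open cubes `[-4ⁿ⁺¹, 4ⁿ⁺¹)ᵈ`. -/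
def bigCube (d n : ℕ) : Set (E d) := {x | ∀ j, x j ∈ Ico (-4 ^ (n + 1) : ℝ) (4 ^ (n + 1))}

theorem exists_mem_bigCube {d : ℕ} (x : E d) : ∃ n, x ∈ bigCube d n := by
  obtain ⟨n, hn⟩ := pow_unbounded_of_one_lt ‖x‖ (by norm_num : (1 : ℝ) < 4)
  refine ⟨n, fun j => ?_⟩
  have h1 := (PiLp.norm_apply_le x j)
  rw [Real.norm_eq_abs] at h1
  have h2 : (4 : ℝ) ^ n ≤ 4 ^ (n + 1) := pow_le_pow_right₀ (by norm_num) (by omega)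
  have h3 := abs_lt.1 (h1.trans_lt (hn.trans_le h2))
  exact ⟨h3.1.le, h3.2⟩

theorem isBounded_bigCube (d n : ℕ) : Bornology.IsBounded (bigCube d n) := by
  refine (isBounded_cube (0 : E d) (4 * 4 ^ (n + 1))).subset fun x hx j => ?_
  have h1 := hx j
  have h2 : (0 : ℝ) < 4 ^ (n + 1) := by positivity
  simp only [mem_Ico, PiLp.zero_apply, sub_zero] at h1 ⊢
  rw [abs_lt]
  constructor <;> linarith

theorem bigCube_mono (d : ℕ) : Monotone (bigCube d) := by
  intro m n hmn x hx j
  have h : (4 : ℝ) ^ (m + 1) ≤ 4 ^ (n + 1) := pow_le_pow_right₀ (by norm_num) (by omega)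
  exact ⟨by linarith [(hx j).1], by linarith [(hx j).2]⟩

open Classical in
/-- The index of the smallest of the cubes `bigCube d n` that contains `x`. -/
noncomputable def level {d : ℕ} (x : E d) : ℕ := Nat.find (exists_mem_bigCube x)

theorem level_le_iff {d : ℕ} {x : E d} {n : ℕ} : level x ≤ n ↔ x ∈ bigCube d n := by
  classical
  refine ⟨fun h => bigCube_mono d h (Nat.find_spec (exists_mem_bigCube x)), fun h => ?_⟩
  exact Nat.find_min' _ h

/-- The half-side `4 ^ (n + 1) = 2 ^ (2 * (n + 1))` is a multiple of `2 ^ k`, so the big cube is a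
union of lattice cubes of side `2 ^ k`. -/
theorem bigCube_congr {d : ℕ} {k n : ℕ} (hkn : k ≤ n + 1) {x y : E d}
    (h : ∀ j, ⌊y j / 2 ^ k⌋ = ⌊x j / 2 ^ k⌋) (hx : x ∈ bigCube d n) : y ∈ bigCube d n := by
  intro j
  have h2 : (0 : ℝ) < 2 ^ k := by positivity
  obtain ⟨l, hl⟩ := Nat.exists_eq_add_of_le (show k ≤ 2 * (n + 1) by omega)
  have h4 : (4 : ℝ) ^ (n + 1) = ((2 ^ l : ℤ) : ℝ) * 2 ^ k := by
    rw [show (4 : ℝ) = 2 ^ 2 by norm_num, ← pow_mul, hl]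
    push_cast
    ring
  have key : ∀ z : E d, z j ∈ Ico (-4 ^ (n + 1) : ℝ) (4 ^ (n + 1)) ↔
      ⌊z j / 2 ^ k⌋ ∈ Ico (-2 ^ l : ℤ) (2 ^ l) := fun z => by
    rw [mem_Ico, mem_Ico, Int.le_floor, Int.floor_lt, le_div_iff₀ h2, div_lt_iff₀ h2, h4]
    push_cast
    rw [neg_mul]
  rw [key, h j, ← key]
  exact hx j

/-- The cell of `x` lies inside the big cube of its level and misses the previous one; the latter is
where `k = n + 1` is needed in `bigCube_congr`. -/
theorem level_congr {d : ℕ} (x y : E d)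
    (h : ∀ j, ⌊y j / 2 ^ level x⌋ = ⌊x j / 2 ^ level x⌋) : level y = level x := by
  refine le_antisymm (level_le_iff.2 (bigCube_congr (Nat.le_succ _) h (level_le_iff.1 le_rfl))) ?_
  by_contra! hlt
  have h2 : x ∉ bigCube d (level x - 1) := fun hx => by
    have := level_le_iff.2 hx
    omega
  have h3 : y ∈ bigCube d (level x - 1) := level_le_iff.1 (by omega)
  exact h2 (bigCube_congr (by omega) (fun j => (h j).symm) h3)

theorem tendsto_level {d : ℕ} : Tendsto (level (d := d)) (Bornology.cobounded (E d)) atTop := by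
  refine tendsto_atTop.2 fun n => ?_
  filter_upwards [Bornology.isBounded_def.1 (isBounded_bigCube d n)] with x hx
  exact (not_le.1 fun h => hx (level_le_iff.1 h)).le

theorem le_norm_of_level {d : ℕ} {x : E d} (h : 0 < level x) : (4 : ℝ) ^ level x ≤ ‖x‖ := by
  have h1 : x ∉ bigCube d (level x - 1) := fun hx => by
    have := level_le_iff.2 hx
    omega
  simp only [bigCube, mem_ofPred_eq, Nat.sub_add_cancel h, not_forall, mem_Ico, not_and_or,
    not_le, not_lt] at h1
  obtain ⟨j, hj⟩ := h1
  refine le_trans ?_ (PiLp.norm_apply_le x j)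
  rw [Real.norm_eq_abs, le_abs]
  rcases hj with hj | hj
  · right; linarith
  · exact Or.inl hj

/-- The side `2 ^ n` is the square root of the distance scale `4 ^ n`, so one factor `2 ^ n` is left
to absorb `√d / γ`. -/
theorem eventually_level_cells_small {d : ℕ} :
    ∀ γ > 0, ∀ᶠ x in Bornology.cobounded (E d), ∀ y,
      cell level (fun n => 2 ^ n) y = cell level (fun n => 2 ^ n) x → dist y x ≤ γ * ‖x‖ := by
  intro γ hγ
  have h2 : Tendsto (fun n : ℕ => (2 : ℝ) ^ n) atTop atTop :=
    tendsto_pow_atTop_atTop_of_one_lt (by norm_num)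
  filter_upwards [tendsto_level.eventually (h2.eventually_ge_atTop (√d / γ)),
    tendsto_level.eventually (eventually_gt_atTop 0)] with x hx h0 y hy
  refine (dist_le_of_cell_eq (fun n => by positivity) hy).trans ?_
  rw [div_le_iff₀' hγ] at hx
  calc √d * 2 ^ level x ≤ γ * 2 ^ level x * 2 ^ level x := by gcongr
    _ = γ * 4 ^ level x := by rw [mul_assoc, ← mul_pow]; norm_num
    _ ≤ γ * ‖x‖ := by gcongr; exact le_norm_of_level h0

/-- A set with `P` whose density along the dilates of every bounded open set is `m(P)`. -/
theorem exists_tendsto_density {d : ℕ} (hd : d ≠ 0) {P : SetProperty d} {ρ : ℝ}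
    (hP : IsGluable P ρ) (hm : 0 < maxDensity P) :
    ∃ A : Set (E d), LebMeas A ∧ P A ∧
      ∀ Ω : Set (E d), IsOpen Ω → Bornology.IsBounded Ω → Ω.Nonempty →
        Tendsto (fun t : ℝ => density (t • Ω) A) atTop (𝓝 (maxDensity P)) := by
  have hside : ∀ n : ℕ, (0 : ℝ) < 2 ^ n := fun n => by positivity
  choose B hB hPB hBd using fun n : ℕ => exists_dense_on_cube hd hP hm (hside n)
    (sub_lt_self (maxDensity P) (Nat.one_div_pos_of_nat (n := n)))
  obtain ⟨A, hA, hPA, hAB⟩ := exists_glued hP hside level_congr hB hPB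
  refine ⟨A, hA, hPA, fun Ω hO hbd hne => Metric.tendsto_nhds.2 fun η hη => ?_⟩
  have h2 : Tendsto (fun n : ℕ => (2 : ℝ) ^ n) atTop atTop :=
    tendsto_pow_atTop_atTop_of_one_lt (by norm_num)
  have hfar : ∀ᶠ x in Bornology.cobounded (E d),
      ENNReal.ofReal (maxDensity P - η / 2) *
        volume (cell level (fun n => 2 ^ n) ⁻¹' {cell level (fun n => 2 ^ n) x}) ≤
      volume (A ∩ cell level (fun n => 2 ^ n) ⁻¹' {cell level (fun n => 2 ^ n) x}) := by
    -- The margin and the deficit `1 / (n + 1)` of the chosen pieces each take `η / 4`.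
    filter_upwards [tendsto_level.eventually ((((tendsto_marginRatio d ρ).comp h2).eventually_lt_const
      (by linarith : 0 < η / 4))), tendsto_level.eventually (h2.eventually_ge_atTop (2 * ρ)),
      tendsto_level.eventually
      (tendsto_one_div_add_atTop_nhds_zero_nat.eventually_lt_const (by linarith : 0 < η / 4))]
      with x h3 h4 h5
    rw [volume_cell_fiber hside level_congr]
    refine le_trans ?_ ((le_volume_inter_innerCube hP.nonneg (hside _) h4 (hBd _)).trans (hAB x))
    gcongr ENNReal.ofReal ?_ * _
    simp only [Function.comp_apply] at h3
    linarith
  filter_upwards [eventually_le_density hd (measurableSet_cell_fiber hside level_congr)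
      eventually_level_cells_small hA hfar hO hbd hne (η := η / 4) (by linarith),
    eventually_density_le_maxDensity hd hP hA hPA hO hbd hne (half_pos hη)] with t h3 h4
  rw [Real.dist_eq, abs_lt]
  constructor <;> linarith

/-- The extremal set already has ball density `m(P)`, and the upper bound along dilates applies to
the unit ball. -/
theorem ballMaxDensity_eq {d : ℕ} (hd : d ≠ 0) {P : SetProperty d} {ρ : ℝ}
    (hP : IsGluable P ρ) (hm : 0 < maxDensity P) : ballMaxDensity P = maxDensity P := by
  obtain ⟨A, hA, hPA, h⟩ := exists_tendsto_density hd hP hm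
  refine IsGreatest.csSup_eq ⟨⟨A, hA, hPA, ?_⟩, ?_⟩
  · rw [ballUpperDensity_eq]
    exact (h _ Metric.isOpen_ball Metric.isBounded_ball ⟨0, by simp⟩).limsup_eq.symm
  · rintro _ ⟨B, hB, hPB, rfl⟩
    rw [ballUpperDensity_eq]
    refine le_of_forall_pos_le_add fun η hη => limsup_le_of_le (isCoboundedUnder_density _ _) ?_
    exact eventually_density_le_maxDensity hd hP hB hPB Metric.isOpen_ball
      Metric.isBounded_ball ⟨0, by simp⟩ hη

end Supersat

theorem mainTheorem8 (d : ℕ) (hd : 2 ≤ d) (P : Supersat.SetProperty d)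
    (hsat : Supersat.IsSupersaturable P) (hfin : Supersat.IsBoundedlyFinite P) :
    (∃ A : Set (Supersat.E d), Supersat.LebMeas A ∧ P A ∧
      ∀ Ω : Set (Supersat.E d), IsOpen Ω → Bornology.IsBounded Ω → Ω.Nonempty →
        Tendsto (fun t : ℝ => Supersat.density (t • Ω) A) atTop (𝓝 (Supersat.maxDensity P))) ∧
    Supersat.ballMaxDensity P = Supersat.maxDensity P := by
  have hm : 0 < Supersat.maxDensity P := hsat.elim fun _ hI => hI.nontriviality
  obtain ⟨ρ, hP⟩ := Supersat.exists_isGluable hsat hfin (Supersat.exists_of_maxDensity_pos hm)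
  have hd0 : d ≠ 0 := by omega
  exact ⟨Supersat.exists_tendsto_density hd0 hP hm, Supersat.ballMaxDensity_eq hd0 hP hm⟩
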